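/- Let $F$ be a free group (of arbitrary rank), $R$ a normal subgroup of $F$, and $F'=[F,F]$ the derived subgroup of $F$. Let $\mathbb Z[F]$ be the integral group ring of $F$ and $\mathfrak f$ its augmentation ideal. For a subgroup $S$ of $F$ write $S-1=\{s-1 : s\in S\}\subseteq\mathbb Z[F]$; products of subsets of $\mathbb Z[F]$ are understood as the additive subgroups generated by all products of their elements. Define ideals ${\bf r}(k)$ of $\mathbb Z[F]$ by ${\bf r}(0)=(R-1)\mathbb Z[F]$ and ${\bf r}(k+1)=\mathfrak f\,{\bf r}(k)+{\bf r}(k)\,\mathfrak f$ for $k\ge 0$, and let $\gamma_n(F)$ denote the lower central series, with $\gamma_1(F)=F$ and $\gamma_{n+1}(F)=[\gamma_n(F),F]$. Then $$F\cap\bigl(1+\mathfrak f(R\cap F'-1)+(R\cap F'-1)\mathfrak f+{\bf r}(2)+\mathfrak f^4\bigr)=[R\cap F',\,F]\,\gamma_4(F).$$ -/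

import Mathlib

noncomputable section

namespace DimensionSubgroup

variable (F : Type*) [Group F]

/-- The augmentation ideal `𝔣` of the integral group ring `ℤ[F]`, as an additive subgroup:
the kernel of the ring homomorphism `ℤ[F] → ℤ` that sends every element of `F` to `1`. -/
def augIdeal : Submodule ℤ (MonoidAlgebra ℤ F) :=
  LinearMap.ker (MonoidAlgebra.lift ℤ ℤ F (1 : F →* ℤ)).toLinearMap

variable {F}

/-- The additive subgroup `S - 1` of `ℤ[F]` generated by the elements `s - 1`, `s ∈ S`.
Products and sums below are those of additive subgroups of `ℤ[F]`: the product `A * B` is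
generated by all `a * b` with `a ∈ A` and `b ∈ B`. -/
def subOne (S : Subgroup F) : Submodule ℤ (MonoidAlgebra ℤ F) :=
  Submodule.span ℤ {x | ∃ s ∈ S, x = MonoidAlgebra.of ℤ F s - 1}

/-- `𝐫(0) = (R - 1) ℤ[F]` and `𝐫(k + 1) = 𝔣 𝐫(k) + 𝐫(k) 𝔣`. -/
def rIdeal (R : Subgroup F) : ℕ → Submodule ℤ (MonoidAlgebra ℤ F)
  | 0 => subOne R * ⊤
  | k + 1 => augIdeal F * rIdeal R k + rIdeal R k * augIdeal F

/-- The subset `F ∩ (1 + J)` of `F`. -/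
def interOneAdd (J : Submodule ℤ (MonoidAlgebra ℤ F)) : Set F :=
  {w | ∃ u ∈ J, MonoidAlgebra.of ℤ F w = 1 + u}

variable (F)

/-- `γ_n(F)`, the `n`-th term of the lower central series for `n ≥ 1`, with `γ_1(F) = F`;
Mathlib numbers the terms from `0`. -/
def gammaTerm (n : ℕ) : Subgroup F :=
  (⊤ : Subgroup F).lowerCentralSeries (n - 1)

end DimensionSubgroup

end

/-! ### Trilinear forms satisfying the Jacobi identity as antisymmetrizations. -/

open scoped DirectSum commutatorElement

/-! Write `S = R ∩ F'`, `N = [S, F] γ₄(F)`, and let `J` be the sum of ideals in the statement. That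
`N` lies in `1 + J` is a direct commutator computation. Conversely, `J ⊆ 𝔣³`, so any `w ∈ F ∩ (1 +
J)` lies in `γ₃(F)`. If `w ∉ N`, then, since `γ₃(F)` is central modulo `N`, some circle-valued
character `φ` of `γ₃(F)`, trivial on `N`, has `φ w ≠ 0`. It remains to extend `φ` to a linear
functional on `ℤ[F]` that vanishes on `J`.

The map `(x, y, z) ↦ φ [[x, y], z]` induces a trilinear form `β` on `A = (F/R)ᵃᵇ` that is
alternating in `x, y` and satisfies Jacobi. The key fact (`exists_symmetric_of_jacobi`) is that `β a
b c = τ a b c - τ b a c` with `τ` trilinear and symmetric in its last two slots. It is explicit on a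
sum of cyclic groups; compactness of the circle passes to arbitrary `A`.

By freeness, `τ` yields a homomorphism from `F` to unitriangular `4 × 4` matrices (`CubicCocycle`).
Its corner entry `d` is the functional: the antisymmetrization identity gives `d = φ` on `γ₃(F)`
(`d_eq_of_mem`), while the symmetry of `τ`, together with `φ [S, F] = 0` and the vanishing of the
superdiagonal on `R`, gives `d(J) = 0` (`cubicIdeal_le_ker`). -/

theorem AddCommGroup.exists_independent_generators (A : Type*) [AddCommGroup A] [AddGroup.FG A] :
    ∃ (ι : Type) (_ : Fintype ι) (x : ι → A), (∀ a, ∃ c : ι → ℤ, ∑ i, c i • x i = a) ∧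
      ∀ c : ι → ℤ, ∑ i, c i • x i = 0 → ∀ i, c i • x i = 0 := by
  classical
  obtain ⟨n, ι, hι, p, -, e, ⟨f⟩⟩ := AddCommGroup.equiv_free_prod_directSum_zmod A
  let y : Fin n ⊕ ι → (Fin n →₀ ℤ) × ⨁ i, ZMod (p i ^ e i) :=
    Sum.elim (fun i => (Finsupp.single i 1, 0))
      (fun j => (0, DirectSum.of (fun i => ZMod (p i ^ e i)) j 1))
  have fst_sum (c : Fin n ⊕ ι → ℤ) (i : Fin n) : (∑ i, c i • y i).1 i = c (.inl i) := by
    simp [y, Prod.fst_sum, Finsupp.single_apply]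
  have snd_sum (c : Fin n ⊕ ι → ℤ) (j : ι) :
      (∑ i, c i • y i).2 j = (c (.inr j) : ZMod (p j ^ e j)) := by
    have : (∑ i, c i • y i).2 = ∑ j, DirectSum.of (fun i => ZMod (p i ^ e i)) j (c (.inr j)) := by
      change AddMonoidHom.snd (Fin n →₀ ℤ) (⨁ i, ZMod (p i ^ e i)) _ = _
      rw [map_sum, Fintype.sum_sum_type]
      simp only [map_zsmul, y, Sum.elim_inl, Sum.elim_inr, AddMonoidHom.coe_snd, smul_zero,
        Finset.sum_const_zero, zero_add]
      exact Finset.sum_congr rfl fun j _ => by rw [← map_zsmul, zsmul_one]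
    rw [this, DirectSum.sum_apply, Finset.sum_eq_single j]
    · exact DirectSum.of_eq_same _ _
    · intro b _ hb
      exact DirectSum.of_eq_of_ne _ _ _ hb.symm
    · simp
  refine ⟨Fin n ⊕ ι, inferInstance, fun i => f.symm (y i), fun a => ?_, fun c hc => ?_⟩
  · refine ⟨Sum.elim (fun i => (f a).1 i) (fun j => ((f a).2 j).cast), ?_⟩
    simp only [← map_zsmul]
    rw [← map_sum, AddEquiv.symm_apply_eq]
    refine Prod.ext (Finsupp.ext fun i => ?_) (DFinsupp.ext fun j => ?_)
    · rw [fst_sum]; rfl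
    · rw [snd_sum]; simp
  · simp only [← map_zsmul] at hc ⊢
    rw [← map_sum, map_eq_zero_iff _ f.symm.injective] at hc
    have h1 := fun i => fst_sum c i
    have h2 := fun j => snd_sum c j
    rw [hc] at h1 h2
    rintro (i | j)
    · simp [← h1 i]
    · rw [map_eq_zero_iff _ f.symm.injective]
      refine Prod.ext (by simp [y]) ?_
      simp only [y, Sum.elim_inr, Prod.smul_snd, Prod.snd_zero]
      rw [← map_zsmul, zsmul_eq_mul, mul_one, ← h2 j]
      exact map_zero _

/-- If a bracket on triples of indices from a linear order is alternating in its first two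
arguments and satisfies the Jacobi identity, then it is the antisymmetrization of a function
that is symmetric in its last two arguments and takes its values in multiples of the bracket. -/
theorem exists_symmetric_of_jacobi_indices {ι D : Type*} [AddCommGroup D]
    (b : ι → ι → ι → D) (h0 : ∀ i k, b i i k = 0) (ha : ∀ i j k, b j i k = - b i j k)
    (hJ : ∀ i j k, b i j k + b j k i + b k i j = 0) :
    ∃ t : ι → ι → ι → D, (∀ i j k, t i j k = t i k j) ∧
      (∀ i j k, t i j k - t j i k = b i j k) ∧
      ∀ i j k, t i j k = 0 ∨ t i j k = b i j k ∨ t i j k = b i k j := by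
  classical
  let _ : LinearOrder ι := linearOrderOfSTO WellOrderingRel
  -- Modelled on basic commutators `[x_i, x_j, x_k]` with `i > j ≤ k`: these brackets are kept, and
  -- Jacobi rewrites the others in terms of them.
  refine ⟨fun i j k => if min j k ≤ i then b i (min j k) (max j k) else 0, fun i j k => ?_,
    fun i j k => ?_, fun i j k => ?_⟩
  · simp only [min_comm, max_comm]
  · dsimp only
    have key (i j : ι) (h : i < j) : (if min j k ≤ i then b i (min j k) (max j k) else 0) -
        (if min i k ≤ j then b j (min i k) (max i k) else 0) = b i j k := by
      rcases le_total i k with h' | h'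
      · have h1 : (if min j k ≤ i then b i (min j k) (max j k) else 0) = 0 := by
          split_ifs with h2
          · obtain rfl : k = i := by rcases min_le_iff.1 h2 with h3 | h3 <;> order
            rw [min_eq_right h.le, h0]
          · rfl
        rw [min_eq_left h', max_eq_right h', if_pos h.le, h1, ha i j, zero_sub, neg_neg]
      · rw [min_eq_right h', max_eq_left h', min_eq_right (h'.trans h.le),
          max_eq_left (h'.trans h.le), if_pos h', if_pos (h'.trans h.le), sub_eq_iff_eq_add,
          ha k i, neg_eq_iff_add_eq_zero, ← hJ i j k]
        abel
    rcases lt_trichotomy i j with h | rfl | h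
    · exact key i j h
    · simp [h0]
    · rw [← neg_sub, key j i h, ha j i k]
  · dsimp only
    split_ifs
    · rcases le_total j k with h | h <;> simp [h]
    · simp

/-- The index version, applied to generators of a cyclic decomposition of `H`, is extended by
coordinates. Here `τ` is a function on all of `A`, so that the solutions for different `H` lie in
one compact product space. -/
theorem exists_symmetric_on_fg_of_jacobi {A D : Type*} [AddCommGroup A] [AddCommGroup D]
    (β : A →+ A →+ A →+ D) (h0 : ∀ x y, β x x y = 0)
    (hJ : ∀ x y z, β x y z + β y z x + β z x y = 0) (H : AddSubgroup A) (hH : H.FG) :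
    ∃ τ : A → A → A → D, (∀ a ∈ H, ∀ a' ∈ H, ∀ b c, τ (a + a') b c = τ a b c + τ a' b c) ∧
      (∀ a b c, τ a b c = τ a c b) ∧
      ∀ a ∈ H, ∀ b ∈ H, ∀ c ∈ H, τ a b c - τ b a c = β a b c := by
  classical
  have : AddGroup.FG H := (AddGroup.fg_iff_addSubgroup_fg H).2 hH
  obtain ⟨ι, _, x, hgen, hind⟩ := AddCommGroup.exists_independent_generators H
  have h0' (x y z : A) : β y x z = - β x y z := by
    have := h0 (x + y) z
    simp only [map_add, AddMonoidHom.add_apply, h0] at this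
    rw [zero_add, add_zero] at this
    exact eq_neg_of_add_eq_zero_left this
  obtain ⟨t, hsymm, hanti, hval⟩ := exists_symmetric_of_jacobi_indices
    (fun i j k => β (x i) (x j) (x k)) (fun i k => h0 _ _) (fun i j k => h0' _ _ _)
    (fun i j k => hJ _ _ _)
  -- Every nonzero value of `t i j k` is a `β` with `x i` in the first slot, so the order of `x i`
  -- annihilates it.
  have ht (n : ℤ) (i : ι) (hn : n • x i = 0) (j k : ι) : n • t i j k = 0 := by
    have hn' : n • (x i : A) = 0 := by exact_mod_cast congrArg Subtype.val hn
    have hβ (y z : A) : n • β (x i) y z = 0 := by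
      rw [← AddMonoidHom.smul_apply, ← AddMonoidHom.smul_apply, ← map_zsmul, hn']
      simp
    rcases hval i j k with h | h | h <;> rw [h]
    · simp
    · exact hβ _ _
    · exact hβ _ _
  choose c hc using hgen
  -- Coordinates are chosen arbitrarily (zero outside `H`), hence additive only up to relations; by
  -- independence these relations hold one generator at a time, where `ht` kills them.
  let r : A → ι → ℤ := fun a => if h : a ∈ H then c ⟨a, h⟩ else 0
  have hr (a : A) (ha : a ∈ H) : ∑ i, r a i • (x i : A) = a := by
    simp only [r, dif_pos ha]
    simpa using congrArg Subtype.val (hc ⟨a, ha⟩)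
  refine ⟨fun a b c => ∑ i, ∑ j, ∑ k, (r a i * (r b j * r c k)) • t i j k, ?_, ?_, ?_⟩
  · intro a ha a' ha' b c
    have hd (i : ι) : (r (a + a') i - (r a i + r a' i)) • x i = 0 := by
      refine hind (fun i => r (a + a') i - (r a i + r a' i)) ?_ i
      apply Subtype.ext
      simp only [sub_smul, add_smul, Finset.sum_sub_distrib, Finset.sum_add_distrib]
      push_cast
      rw [hr _ ha, hr _ ha', hr _ (H.add_mem ha ha'), sub_self]
    simp only [← Finset.sum_add_distrib]
    refine Finset.sum_congr rfl fun i _ => Finset.sum_congr rfl fun j _ =>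
      Finset.sum_congr rfl fun k _ => ?_
    have := congrArg ((r b j * r c k) • ·) (ht _ i (hd i) j k)
    simp only [smul_zero, smul_smul] at this
    rw [← sub_eq_zero, ← this, ← add_smul, ← sub_smul]
    congr 1
    ring
  · intro a b c
    refine Finset.sum_congr rfl fun i _ => ?_
    rw [Finset.sum_comm]
    refine Finset.sum_congr rfl fun k _ => Finset.sum_congr rfl fun j _ => ?_
    rw [hsymm i j k, mul_comm (r b j)]
  · intro a ha b hb c hc
    have hcomm : ∑ i, ∑ j, ∑ k, (r b i * (r a j * r c k)) • t i j k =
        ∑ i, ∑ j, ∑ k, (r a i * (r b j * r c k)) • t j i k := by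
      rw [Finset.sum_comm]
      refine Finset.sum_congr rfl fun i _ => Finset.sum_congr rfl fun j _ =>
        Finset.sum_congr rfl fun k _ => ?_
      congr 1
      ring
    dsimp only
    rw [hcomm]
    have h1 : β a b c = ∑ i, r a i • β (x i) b c := by
      conv_lhs => rw [← hr a ha]
      simp only [map_sum, AddMonoidHom.finsetSum_apply, map_zsmul, AddMonoidHom.smul_apply]
    have h2 (u : A) : β u b c = ∑ j, r b j • β u (x j) c := by
      conv_lhs => rw [← hr b hb]
      simp only [map_sum, AddMonoidHom.finsetSum_apply, map_zsmul, AddMonoidHom.smul_apply]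
    have h3 (u v : A) : β u v c = ∑ k, r c k • β u v (x k) := by
      conv_lhs => rw [← hr c hc]
      simp only [map_sum, map_zsmul]
    rw [h1]
    simp only [h2 (x _ : A), h3, Finset.smul_sum, smul_smul, ← Finset.sum_sub_distrib, ← smul_sub,
      hanti]

/-- A trilinear form with values in the circle that is alternating in its first two arguments and
satisfies the Jacobi identity is the antisymmetrization of a trilinear form that is symmetric in
its last two arguments. -/
theorem exists_symmetric_of_jacobi {A : Type*} [AddCommGroup A]
    (β : A →+ A →+ A →+ AddCircle (1 : ℝ)) (h0 : ∀ x y, β x x y = 0)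
    (hJ : ∀ x y z, β x y z + β y z x + β z x y = 0) :
    ∃ τ : A →+ A →+ A →+ AddCircle (1 : ℝ), (∀ a b c, τ a b c = τ a c b) ∧
      ∀ a b c, τ a b c - τ b a c = β a b c := by
  let Z : {H : AddSubgroup A // H.FG} → Set (A → A → A → AddCircle (1 : ℝ)) := fun H =>
    {τ | (∀ a ∈ H.1, ∀ a' ∈ H.1, ∀ b c, τ (a + a') b c = τ a b c + τ a' b c) ∧
      (∀ a b c, τ a b c = τ a c b) ∧
      ∀ a ∈ H.1, ∀ b ∈ H.1, ∀ c ∈ H.1, τ a b c - τ b a c = β a b c}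
  have hclosed (H) : IsClosed (Z H) := by
    simp only [Z, Set.ofPred_and, Set.ofPred_forall]
    refine .inter ?_ (.inter ?_ ?_)
    · refine isClosed_iInter fun a => isClosed_iInter fun _ => isClosed_iInter fun a' =>
        isClosed_iInter fun _ => isClosed_iInter fun b => isClosed_iInter fun c =>
        isClosed_eq (by fun_prop) (by fun_prop)
    · refine isClosed_iInter fun a => isClosed_iInter fun b => isClosed_iInter fun c =>
        isClosed_eq (by fun_prop) (by fun_prop)
    · refine isClosed_iInter fun a => isClosed_iInter fun _ => isClosed_iInter fun b =>
        isClosed_iInter fun _ => isClosed_iInter fun c => isClosed_iInter fun _ =>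
        isClosed_eq (by fun_prop) (by fun_prop)
  have hanti (H K : {H : AddSubgroup A // H.FG}) (h : H.1 ≤ K.1) : Z K ⊆ Z H :=
    fun τ hτ => ⟨fun a ha a' ha' => hτ.1 a (h ha) a' (h ha'), hτ.2.1,
      fun a ha b hb c hc => hτ.2.2 a (h ha) b (h hb) c (h hc)⟩
  have : Nonempty {H : AddSubgroup A // H.FG} := ⟨⟨⊥, AddSubgroup.FG.bot⟩⟩
  have : Fact ((0 : ℝ) < 1) := ⟨one_pos⟩
  -- Tychonoff: the solution sets are closed in a power of the circle, nonempty and directed.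
  obtain ⟨τ, hτ⟩ := IsCompact.nonempty_iInter_of_directed_nonempty_isCompact_isClosed Z
    (fun H K => ⟨⟨H.1 ⊔ K.1, H.2.sup K.2⟩, hanti _ _ le_sup_left, hanti _ _ le_sup_right⟩)
    (fun H => exists_symmetric_on_fg_of_jacobi β h0 hJ H.1 H.2)
    (fun H => (hclosed H).isCompact) hclosed
  rw [Set.mem_iInter] at hτ
  have hfg (s : Finset A) : (AddSubgroup.closure (s : Set A)).FG := ⟨s, rfl⟩
  have mem (s : Finset A) {a : A} (h : a ∈ s) : a ∈ AddSubgroup.closure (s : Set A) :=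
    AddSubgroup.subset_closure h
  classical
  have hadd (a a' b c : A) : τ (a + a') b c = τ a b c + τ a' b c :=
    (hτ ⟨_, hfg {a, a'}⟩).1 a (mem _ (by simp)) a' (mem _ (by simp)) b c
  have hsymm : ∀ a b c, τ a b c = τ a c b := (hτ ⟨_, hfg ∅⟩).2.1
  have hdiff (a b c : A) : τ a b c - τ b a c = β a b c :=
    (hτ ⟨_, hfg {a, b, c}⟩).2.2 a (mem _ (by simp)) b (mem _ (by simp)) c (mem _ (by simp))
  -- Swapping the first two slots costs only `β`, which is additive, so additivity passes from the
  -- first slot to the second and by symmetry to the third.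
  have hadd₂ (a b b' c : A) : τ a (b + b') c = τ a b c + τ a b' c := by
    have h (b : A) : τ a b c = β a b c + τ b a c := by rw [← hdiff]; abel
    rw [h, h, h, hadd]
    simp only [map_add, AddMonoidHom.add_apply]
    abel
  have hadd₃ (a b c c' : A) : τ a b (c + c') = τ a b c + τ a b c' := by
    rw [hsymm, hadd₂, hsymm a c, hsymm a c']
  exact ⟨AddMonoidHom.mk' (fun a => AddMonoidHom.mk' (fun b => AddMonoidHom.mk' (τ a b)
      (hadd₃ a b)) fun b b' => AddMonoidHom.ext (hadd₂ a b b'))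
      fun a a' => AddMonoidHom.ext fun b => AddMonoidHom.ext (hadd a a' b), hsymm, hdiff⟩

/-! ### Homomorphisms into unitriangular matrices. -/

/-- Upper unitriangular `4 × 4` matrices with entries determined by the first row, the first
superdiagonal entry `a` and the entry `c` in position `(2, 4)`: the superdiagonal is `a`, `ν₁ a`,
`ν₂ a`. -/
@[ext]
structure UnitriangularFour {A B D : Type*} [AddCommGroup A] [AddCommGroup B] [AddCommGroup D]
    (ν₁ : A →+ A →+ B) (ν₂ : A →+ B →+ D) where
  a : A
  b : B
  c : A →+ D
  d : D

namespace UnitriangularFour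

variable {A B D : Type*} [AddCommGroup A] [AddCommGroup B] [AddCommGroup D]
  {ν₁ : A →+ A →+ B} {ν₂ : A →+ B →+ D}

instance : Mul (UnitriangularFour ν₁ ν₂) :=
  -- Entries compose as maps `ℤ → A → B → D`, so this is the matrix product in the opposite order:
  -- entries of `g` are applied to those of `h`.
  ⟨fun g h => ⟨g.a + h.a, g.b + h.b + ν₁ g.a h.a, g.c + h.c + (ν₂ g.a).comp (ν₁ h.a),
    g.d + h.d + g.c h.a + ν₂ g.a h.b⟩⟩

instance : One (UnitriangularFour ν₁ ν₂) := ⟨⟨0, 0, 0, 0⟩⟩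

instance : Inv (UnitriangularFour ν₁ ν₂) :=
  ⟨fun g => ⟨-g.a, -g.b + ν₁ g.a g.a, -g.c + (ν₂ g.a).comp (ν₁ g.a),
    -g.d + g.c g.a - ν₂ g.a (ν₁ g.a g.a) + ν₂ g.a g.b⟩⟩

theorem mul_def (g h : UnitriangularFour ν₁ ν₂) :
    g * h = ⟨g.a + h.a, g.b + h.b + ν₁ g.a h.a, g.c + h.c + (ν₂ g.a).comp (ν₁ h.a),
      g.d + h.d + g.c h.a + ν₂ g.a h.b⟩ := rfl

theorem one_def : (1 : UnitriangularFour ν₁ ν₂) = ⟨0, 0, 0, 0⟩ := rfl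

theorem inv_def (g : UnitriangularFour ν₁ ν₂) :
    g⁻¹ = ⟨-g.a, -g.b + ν₁ g.a g.a, -g.c + (ν₂ g.a).comp (ν₁ g.a),
      -g.d + g.c g.a - ν₂ g.a (ν₁ g.a g.a) + ν₂ g.a g.b⟩ := rfl

instance : Group (UnitriangularFour ν₁ ν₂) :=
  Group.ofLeftAxioms
    (fun g h k => by
      ext <;> simp [mul_def] <;> abel)
    (fun g => by ext <;> simp [mul_def, one_def])
    (fun g => by
      ext <;> simp [mul_def, one_def, inv_def]
      abel)

end UnitriangularFour

/-- The entries of a homomorphism from `F` to the group `UnitriangularFour ν₁ ν₂`. -/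
structure CubicCocycle (F : Type*) [Group F] {A B D : Type*} [AddCommGroup A] [AddCommGroup B]
    [AddCommGroup D] (ν₁ : A →+ A →+ B) (ν₂ : A →+ B →+ D) where
  a : F → A
  b : F → B
  c : F → A →+ D
  d : F → D
  a_mul (g h : F) : a (g * h) = a g + a h
  b_mul (g h : F) : b (g * h) = b g + b h + ν₁ (a g) (a h)
  c_mul (g h : F) (x : A) : c (g * h) x = c g x + c h x + ν₂ (a g) (ν₁ (a h) x)
  d_mul (g h : F) : d (g * h) = d g + d h + c g (a h) + ν₂ (a g) (b h)

/-- On a free group the generators may be sent anywhere; all entries except `a` (and those it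
forces) are set to zero there. -/
theorem CubicCocycle.exists_of_isFreeGroup {F : Type*} [Group F] [IsFreeGroup F] {A B D : Type*}
    [AddCommGroup A] [AddCommGroup B] [AddCommGroup D] (ν₁ : A →+ A →+ B) (ν₂ : A →+ B →+ D)
    (α : F →* Multiplicative A) :
    ∃ T : CubicCocycle F ν₁ ν₂, ∀ g, T.a g = (α g).toAdd := by
  let f : F →* UnitriangularFour ν₁ ν₂ :=
    IsFreeGroup.lift fun i => ⟨(α (IsFreeGroup.of i)).toAdd, 0, 0, 0⟩
  let T : CubicCocycle F ν₁ ν₂ :=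
    { a := fun g => (f g).a
      b := fun g => (f g).b
      c := fun g => (f g).c
      d := fun g => (f g).d
      a_mul := fun g h => by rw [map_mul]; rfl
      b_mul := fun g h => by rw [map_mul]; rfl
      c_mul := fun g h x => by rw [map_mul]; rfl
      d_mul := fun g h => by rw [map_mul]; rfl }
  let α' : F →* Multiplicative A := MonoidHom.mk' (fun g => .ofAdd (T.a g)) T.a_mul
  have h : α' = α := IsFreeGroup.ext_hom fun i => by
    change Multiplicative.ofAdd (f (IsFreeGroup.of i)).a = _
    simp [f]
  exact ⟨T, fun g => congrArg Multiplicative.toAdd (DFunLike.congr_fun h g)⟩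

/-! ### Linear functionals on the group ring and the augmentation ideal. -/

namespace DimensionSubgroup

variable {F : Type*} [Group F]

/-- The linear extension to `ℤ[F]` of a function on `F`. -/
noncomputable def linearExtension {D : Type*} [AddCommGroup D] (t : F → D) : MonoidAlgebra ℤ F →ₗ[ℤ] D :=
  Finsupp.linearCombination ℤ t ∘ₗ (MonoidAlgebra.coeffLinearEquiv ℤ).toLinearMap

theorem linearExtension_of {D : Type*} [AddCommGroup D] (t : F → D) (g : F) :
    linearExtension t (MonoidAlgebra.of ℤ F g) = t g := by
  simp [linearExtension]

theorem linearExtension_one {D : Type*} [AddCommGroup D] (t : F → D) :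
    linearExtension t 1 = t 1 := by
  rw [← linearExtension_of t 1, MonoidHom.map_one]

theorem mem_augIdeal {u : MonoidAlgebra ℤ F} :
    u ∈ augIdeal F ↔ MonoidAlgebra.lift ℤ ℤ F (1 : F →* ℤ) u = 0 := Iff.rfl

theorem of_sub_one_mem_augIdeal (g : F) : MonoidAlgebra.of ℤ F g - 1 ∈ augIdeal F := by
  rw [mem_augIdeal, map_sub, MonoidAlgebra.lift_of, map_one]
  simp

theorem augIdeal_eq_subOne_top : augIdeal F = subOne (⊤ : Subgroup F) := by
  apply le_antisymm
  · have key (u : MonoidAlgebra ℤ F) :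
        u - MonoidAlgebra.lift ℤ ℤ F (1 : F →* ℤ) u • 1 ∈ subOne (⊤ : Subgroup F) := by
      induction u using MonoidAlgebra.induction_on with
      | of g => exact Submodule.subset_span ⟨g, trivial, by simp⟩
      | add x y hx hy =>
        rw [map_add, add_smul, add_sub_add_comm]
        exact add_mem hx hy
      | smul r x hx =>
        rw [map_smul, smul_assoc, ← smul_sub]
        exact Submodule.smul_mem _ r hx
    intro u hu
    have := key u
    rwa [mem_augIdeal.1 hu, zero_smul, sub_zero] at this
  · rw [subOne, Submodule.span_le]
    rintro _ ⟨g, -, rfl⟩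
    exact of_sub_one_mem_augIdeal g

theorem subOne_mul_le {S : Subgroup F} {J K : Submodule ℤ (MonoidAlgebra ℤ F)}
    (h : ∀ g ∈ S, ∀ u ∈ J, (MonoidAlgebra.of ℤ F g - 1) * u ∈ K) : subOne S * J ≤ K := by
  rw [Submodule.mul_le]
  intro m hm u hu
  induction hm using Submodule.span_induction with
  | mem x hx => obtain ⟨g, hg, rfl⟩ := hx; exact h g hg u hu
  | zero => rw [zero_mul]; exact zero_mem _
  | add x y _ _ hx hy => rw [add_mul]; exact add_mem hx hy
  | smul r x _ hx => rw [smul_mul_assoc]; exact Submodule.smul_mem _ r hx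

theorem augIdeal_mul_le {J K : Submodule ℤ (MonoidAlgebra ℤ F)}
    (h : ∀ g, ∀ u ∈ J, (MonoidAlgebra.of ℤ F g - 1) * u ∈ K) : augIdeal F * J ≤ K := by
  rw [augIdeal_eq_subOne_top]
  exact subOne_mul_le fun g _ => h g

theorem subOne_mono {S S' : Subgroup F} (h : S ≤ S') : subOne S ≤ subOne S' :=
  Submodule.span_mono fun _ ⟨s, hs, hx⟩ => ⟨s, h hs, hx⟩

theorem subOne_le_augIdeal (S : Subgroup F) : subOne S ≤ augIdeal F := by
  rw [augIdeal_eq_subOne_top]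
  exact subOne_mono le_top

theorem mul_augIdeal_le (J : Submodule ℤ (MonoidAlgebra ℤ F)) : J * augIdeal F ≤ augIdeal F := by
  rw [Submodule.mul_le]
  intro m _ n hn
  rw [mem_augIdeal] at hn ⊢
  rw [map_mul, hn, mul_zero]

theorem augIdeal_mul_top_le (J : Submodule ℤ (MonoidAlgebra ℤ F)) :
    augIdeal F * J ≤ augIdeal F := by
  rw [Submodule.mul_le]
  intro m hm n _
  rw [mem_augIdeal] at hm ⊢
  rw [map_mul, hm, zero_mul]

theorem rIdeal_zero_le_augIdeal (R : Subgroup F) : rIdeal R 0 ≤ augIdeal F :=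
  (mul_le_mul' (subOne_le_augIdeal R) le_rfl).trans (augIdeal_mul_top_le _)

theorem rIdeal_zero_mul_augIdeal_le (R : Subgroup F) :
    rIdeal R 0 * augIdeal F ≤ subOne R * augIdeal F := by
  rw [rIdeal, mul_assoc]
  exact mul_le_mul' le_rfl (mul_augIdeal_le _)

end DimensionSubgroup

/-! ### Ideals killed by the matrix entries. -/

namespace CubicCocycle

open DimensionSubgroup

variable {F : Type*} [Group F] {A B D : Type*} [AddCommGroup A] [AddCommGroup B] [AddCommGroup D]
  {ν₁ : A →+ A →+ B} {ν₂ : A →+ B →+ D} (T : CubicCocycle F ν₁ ν₂)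

theorem a_one : T.a 1 = 0 := by simpa using T.a_mul 1 1

theorem b_one : T.b 1 = 0 := by simpa [T.a_one] using T.b_mul 1 1

theorem d_one : T.d 1 = 0 := by simpa [T.a_one, T.b_one] using T.d_mul 1 1

theorem a_eq_zero {g : F} (hg : g ∈ commutator F) : T.a g = 0 := by
  let α : F →* Multiplicative A := MonoidHom.mk' (fun g => .ofAdd (T.a g)) T.a_mul
  exact congrArg Multiplicative.toAdd (Abelianization.commutator_subset_ker α hg)

/-- For `u = h` the factor `g - 1` cancels the pure `h` term of the cocycle rule; the rest is linear
in `u`. The same holds for `b` and `d` below. -/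
theorem linearExtension_a_mul (g : F) (u : MonoidAlgebra ℤ F) :
    linearExtension T.a ((MonoidAlgebra.of ℤ F g - 1) * u) =
      MonoidAlgebra.lift ℤ ℤ F (1 : F →* ℤ) u • T.a g := by
  induction u using MonoidAlgebra.induction_on with
  | of h =>
    rw [sub_mul, one_mul, ← map_mul, map_sub]
    simp only [linearExtension_of, T.a_mul, MonoidAlgebra.lift_of, MonoidHom.one_apply, one_smul]
    abel
  | add x y hx hy => simp only [mul_add, map_add, hx, hy, add_smul]
  | smul r x hx => simp only [mul_smul_comm, map_smul, hx, smul_assoc]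

theorem linearExtension_b_mul (g : F) (u : MonoidAlgebra ℤ F) :
    linearExtension T.b ((MonoidAlgebra.of ℤ F g - 1) * u) =
      MonoidAlgebra.lift ℤ ℤ F (1 : F →* ℤ) u • T.b g + ν₁ (T.a g) (linearExtension T.a u) := by
  induction u using MonoidAlgebra.induction_on with
  | of h =>
    rw [sub_mul, one_mul, ← map_mul, map_sub]
    simp only [linearExtension_of, T.b_mul, MonoidAlgebra.lift_of, MonoidHom.one_apply, one_smul]
    abel
  | add x y hx hy => simp only [mul_add, map_add, hx, hy, add_smul]; abel
  | smul r x hx => simp only [mul_smul_comm, map_smul, hx, smul_assoc, map_zsmul, smul_add]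

theorem linearExtension_d_mul (g : F) (u : MonoidAlgebra ℤ F) :
    linearExtension T.d ((MonoidAlgebra.of ℤ F g - 1) * u) =
      MonoidAlgebra.lift ℤ ℤ F (1 : F →* ℤ) u • T.d g + T.c g (linearExtension T.a u)
        + ν₂ (T.a g) (linearExtension T.b u) := by
  induction u using MonoidAlgebra.induction_on with
  | of h =>
    rw [sub_mul, one_mul, ← map_mul, map_sub]
    simp only [linearExtension_of, T.d_mul, MonoidAlgebra.lift_of, MonoidHom.one_apply, one_smul]
    abel
  | add x y hx hy => simp only [mul_add, map_add, hx, hy, add_smul]; abel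
  | smul r x hx => simp only [mul_smul_comm, map_smul, hx, smul_assoc, map_zsmul, smul_add]

/-- Elements of the augmentation ideal killed by the entry `a`. -/
noncomputable def kerA : Submodule ℤ (MonoidAlgebra ℤ F) := augIdeal F ⊓ LinearMap.ker (linearExtension T.a)

/-- Elements of the augmentation ideal killed by the entries `a` and `b`. -/
noncomputable def kerB : Submodule ℤ (MonoidAlgebra ℤ F) := T.kerA ⊓ LinearMap.ker (linearExtension T.b)

/-- Elements of the augmentation ideal killed by the entries `a`, `b` and `d`. -/
noncomputable def kerD : Submodule ℤ (MonoidAlgebra ℤ F) := T.kerB ⊓ LinearMap.ker (linearExtension T.d)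

theorem of_sub_one_mul_mem_augIdeal (g : F) (u : MonoidAlgebra ℤ F) :
    (MonoidAlgebra.of ℤ F g - 1) * u ∈ augIdeal F :=
  augIdeal_mul_top_le ⊤ (Submodule.mul_mem_mul (of_sub_one_mem_augIdeal g) trivial)

/-- `augIdeal`, `kerA`, `kerB`, `kerD` behave as weights 1 to 4: left multiplication by `𝔣` raises
the weight by one. -/
theorem augIdeal_mul_augIdeal_le : augIdeal F * augIdeal F ≤ T.kerA :=
  augIdeal_mul_le fun g u hu => ⟨of_sub_one_mul_mem_augIdeal g u, by
    rw [SetLike.mem_coe, LinearMap.mem_ker, T.linearExtension_a_mul, mem_augIdeal.1 hu, zero_smul]⟩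

theorem augIdeal_mul_kerA_le : augIdeal F * T.kerA ≤ T.kerB :=
  augIdeal_mul_le fun g u hu =>
    ⟨T.augIdeal_mul_augIdeal_le (Submodule.mul_mem_mul (of_sub_one_mem_augIdeal g) hu.1), by
      rw [SetLike.mem_coe, LinearMap.mem_ker, T.linearExtension_b_mul, mem_augIdeal.1 hu.1,
        LinearMap.mem_ker.1 hu.2, zero_smul, map_zero, add_zero]⟩

theorem augIdeal_mul_kerB_le : augIdeal F * T.kerB ≤ T.kerD :=
  augIdeal_mul_le fun g u hu =>
    ⟨T.augIdeal_mul_kerA_le (Submodule.mul_mem_mul (of_sub_one_mem_augIdeal g) hu.1), by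
      rw [SetLike.mem_coe, LinearMap.mem_ker, T.linearExtension_d_mul, mem_augIdeal.1 hu.1.1,
        LinearMap.mem_ker.1 hu.1.2, LinearMap.mem_ker.1 hu.2, zero_smul, map_zero, map_zero,
        add_zero, add_zero]⟩

theorem augIdeal_mul_augIdeal_mul_augIdeal_le :
    augIdeal F * (augIdeal F * augIdeal F) ≤ T.kerB :=
  (mul_le_mul' le_rfl T.augIdeal_mul_augIdeal_le).trans T.augIdeal_mul_kerA_le

theorem augIdeal_pow_four_le : augIdeal F ^ 4 ≤ T.kerD := by
  rw [show augIdeal F ^ 4 = augIdeal F * (augIdeal F * (augIdeal F * augIdeal F)) by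
    simp only [pow_succ, pow_zero, one_mul, mul_assoc]]
  exact (mul_le_mul' le_rfl T.augIdeal_mul_augIdeal_mul_augIdeal_le).trans
    T.augIdeal_mul_kerB_le

section

variable {S : Subgroup F} (hS : ∀ g ∈ S, T.a g = 0)
include hS

/-- When `a` vanishes on `S`, a left factor `s - 1` counts with weight two; this and the next two
lemmas record the cases. -/
theorem subOne_mul_le_kerA (J : Submodule ℤ (MonoidAlgebra ℤ F)) : subOne S * J ≤ T.kerA :=
  subOne_mul_le fun g hg u _ => ⟨of_sub_one_mul_mem_augIdeal g u, by
    rw [SetLike.mem_coe, LinearMap.mem_ker, T.linearExtension_a_mul, hS g hg, smul_zero]⟩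

theorem subOne_mul_augIdeal_le_kerB : subOne S * augIdeal F ≤ T.kerB :=
  subOne_mul_le fun g hg u hu =>
    ⟨T.subOne_mul_le_kerA hS _ (Submodule.mul_mem_mul (Submodule.subset_span ⟨g, hg, rfl⟩) hu), by
      rw [SetLike.mem_coe, LinearMap.mem_ker, T.linearExtension_b_mul, hS g hg, mem_augIdeal.1 hu, zero_smul,
        map_zero, AddMonoidHom.zero_apply, add_zero]⟩

theorem subOne_mul_kerA_le_kerD : subOne S * T.kerA ≤ T.kerD :=
  subOne_mul_le fun g hg u hu =>
    ⟨T.subOne_mul_augIdeal_le_kerB hS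
      (Submodule.mul_mem_mul (Submodule.subset_span ⟨g, hg, rfl⟩) hu.1), by
      rw [SetLike.mem_coe, LinearMap.mem_ker, T.linearExtension_d_mul, hS g hg, mem_augIdeal.1 hu.1,
        LinearMap.mem_ker.1 hu.2, zero_smul, map_zero, map_zero, AddMonoidHom.zero_apply,
        add_zero, add_zero]⟩

/-- `𝐫(0)` has weight two and each factor `𝔣` adds one. Weights are tracked through left factors, so
in `𝐫(0) 𝔣` the inner `ℤ[F]` is first absorbed into `𝔣`. -/
theorem rIdeal_two_le_kerD : rIdeal S 2 ≤ T.kerD := by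
  have h0 : rIdeal S 0 ≤ T.kerA := T.subOne_mul_le_kerA hS _
  have h1 : rIdeal S 0 * augIdeal F ≤ T.kerB :=
    (rIdeal_zero_mul_augIdeal_le S).trans (T.subOne_mul_augIdeal_le_kerB hS)
  have h2 : rIdeal S 0 * augIdeal F * augIdeal F ≤ T.kerD := by
    refine (mul_le_mul' (rIdeal_zero_mul_augIdeal_le S) le_rfl).trans ?_
    rw [mul_assoc]
    exact (mul_le_mul' le_rfl T.augIdeal_mul_augIdeal_le).trans
      (T.subOne_mul_kerA_le_kerD hS)
  have h3 : augIdeal F * (rIdeal S 0 * augIdeal F) ≤ T.kerD :=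
    (mul_le_mul' le_rfl h1).trans T.augIdeal_mul_kerB_le
  have h4 : augIdeal F * (augIdeal F * rIdeal S 0) ≤ T.kerD :=
    (mul_le_mul' le_rfl ((mul_le_mul' le_rfl h0).trans
      T.augIdeal_mul_kerA_le)).trans T.augIdeal_mul_kerB_le
  simp only [rIdeal, Submodule.add_eq_sup] at h1 h2 h3 h4 ⊢
  simp only [Submodule.mul_sup, Submodule.sup_mul, sup_le_iff]
  refine ⟨⟨h4, h3⟩, ?_, h2⟩
  rw [mul_assoc]
  exact h3

end

end CubicCocycle

/-! ### Subgroups `F ∩ (1 + J)` and the easy inclusion. -/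

namespace DimensionSubgroup

variable {F : Type*} [Group F]

/-- The subgroup `F ∩ (1 + J)` for an additive subgroup `J` with `J 𝔣 ⊆ J`. -/
noncomputable def oneAddSubgroup (J : Submodule ℤ (MonoidAlgebra ℤ F)) (hJ : J * augIdeal F ≤ J) :
    Subgroup F where
  carrier := {w | MonoidAlgebra.of ℤ F w - 1 ∈ J}
  one_mem' := by
    rw [Set.mem_ofPred_eq, MonoidHom.map_one, sub_self]
    exact zero_mem _
  mul_mem' {v w} hv hw := by
    have h : MonoidAlgebra.of ℤ F (v * w) - 1 = (MonoidAlgebra.of ℤ F v - 1) *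
        (MonoidAlgebra.of ℤ F w - 1) + (MonoidAlgebra.of ℤ F v - 1) +
        (MonoidAlgebra.of ℤ F w - 1) := by
      rw [MonoidHom.map_mul]; noncomm_ring
    rw [Set.mem_ofPred_eq, h]
    exact add_mem (add_mem (hJ (Submodule.mul_mem_mul hv (of_sub_one_mem_augIdeal w))) hv) hw
  inv_mem' {w} hw := by
    have h : MonoidAlgebra.of ℤ F w⁻¹ - 1 = -((MonoidAlgebra.of ℤ F w - 1) *
        (MonoidAlgebra.of ℤ F w⁻¹ - 1)) - (MonoidAlgebra.of ℤ F w - 1) := by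
      have : MonoidAlgebra.of ℤ F w * MonoidAlgebra.of ℤ F w⁻¹ = 1 := by
        rw [← MonoidHom.map_mul, mul_inv_cancel, MonoidHom.map_one]
      rw [sub_mul, mul_sub, this]; noncomm_ring
    rw [Set.mem_ofPred_eq, h]
    exact sub_mem (neg_mem (hJ (Submodule.mul_mem_mul hw (of_sub_one_mem_augIdeal _)))) hw

theorem mem_oneAddSubgroup {J : Submodule ℤ (MonoidAlgebra ℤ F)} {hJ : J * augIdeal F ≤ J}
    {w : F} : w ∈ oneAddSubgroup J hJ ↔ MonoidAlgebra.of ℤ F w - 1 ∈ J := Iff.rfl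

theorem mem_interOneAdd {J : Submodule ℤ (MonoidAlgebra ℤ F)} {w : F} :
    w ∈ interOneAdd J ↔ MonoidAlgebra.of ℤ F w - 1 ∈ J :=
  ⟨fun ⟨u, hu, h⟩ => by rwa [h, add_sub_cancel_left],
    fun h => ⟨_, h, (add_sub_cancel _ _).symm⟩⟩

/-- `[s, g] - 1 = (sg - gs) s⁻¹g⁻¹`; splitting the last factor as `(s⁻¹g⁻¹ - 1) + 1` makes `J 𝔣 ⊆ J`
suffice. -/
theorem commutatorElement_mem_oneAddSubgroup {J : Submodule ℤ (MonoidAlgebra ℤ F)}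
    {hJ : J * augIdeal F ≤ J} {s g : F}
    (h₁ : (MonoidAlgebra.of ℤ F s - 1) * (MonoidAlgebra.of ℤ F g - 1) ∈ J)
    (h₂ : (MonoidAlgebra.of ℤ F g - 1) * (MonoidAlgebra.of ℤ F s - 1) ∈ J) :
    ⁅s, g⁆ ∈ oneAddSubgroup J hJ := by
  have h : MonoidAlgebra.of ℤ F ⁅s, g⁆ - 1 =
      ((MonoidAlgebra.of ℤ F s - 1) * (MonoidAlgebra.of ℤ F g - 1) -
        (MonoidAlgebra.of ℤ F g - 1) * (MonoidAlgebra.of ℤ F s - 1)) *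
        (MonoidAlgebra.of ℤ F (s⁻¹ * g⁻¹) - 1) +
      ((MonoidAlgebra.of ℤ F s - 1) * (MonoidAlgebra.of ℤ F g - 1) -
        (MonoidAlgebra.of ℤ F g - 1) * (MonoidAlgebra.of ℤ F s - 1)) := by
    have e₁ : (MonoidAlgebra.of ℤ F s - 1) * (MonoidAlgebra.of ℤ F g - 1) -
        (MonoidAlgebra.of ℤ F g - 1) * (MonoidAlgebra.of ℤ F s - 1) =
        MonoidAlgebra.of ℤ F (s * g) - MonoidAlgebra.of ℤ F (g * s) := by
      simp only [MonoidHom.map_mul]; noncomm_ring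
    rw [e₁, mul_sub, mul_one, sub_add_cancel, sub_mul, ← MonoidHom.map_mul, ← MonoidHom.map_mul,
      show g * s * (s⁻¹ * g⁻¹) = 1 by group, MonoidHom.map_one, commutatorElement_def]
    simp only [mul_assoc]
  rw [mem_oneAddSubgroup, h]
  exact add_mem (hJ (Submodule.mul_mem_mul (sub_mem h₁ h₂) (of_sub_one_mem_augIdeal _)))
    (sub_mem h₁ h₂)

theorem augIdeal_pow_mul_augIdeal_le (n : ℕ) :
    augIdeal F ^ (n + 1) * augIdeal F ≤ augIdeal F ^ (n + 1) := by
  rw [pow_succ, mul_assoc]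
  exact mul_le_mul' le_rfl (mul_augIdeal_le _)

theorem lowerCentralSeries_le_oneAddSubgroup (n : ℕ) :
    (⊤ : Subgroup F).lowerCentralSeries n ≤
      oneAddSubgroup (augIdeal F ^ (n + 1)) (augIdeal_pow_mul_augIdeal_le n) := by
  induction n with
  | zero =>
    intro w _
    rw [mem_oneAddSubgroup, zero_add, pow_one]
    exact of_sub_one_mem_augIdeal w
  | succ n ih =>
    rw [Subgroup.lowerCentralSeries_succ, Subgroup.commutator_le]
    intro s hs g _
    have hs' := mem_oneAddSubgroup.1 (ih hs)
    apply commutatorElement_mem_oneAddSubgroup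
    · rw [pow_succ]
      exact Submodule.mul_mem_mul hs' (of_sub_one_mem_augIdeal g)
    · rw [pow_succ']
      exact Submodule.mul_mem_mul (of_sub_one_mem_augIdeal g) hs'

theorem subOne_le_sq {S : Subgroup F} (hS : S ≤ commutator F) : subOne S ≤ augIdeal F ^ 2 := by
  rw [subOne, Submodule.span_le]
  rintro _ ⟨s, hs, rfl⟩
  refine lowerCentralSeries_le_oneAddSubgroup 1 ?_
  rw [Subgroup.top_lowerCentralSeries_one]
  exact hS hs

theorem rIdeal_two_le_cube (R : Subgroup F) : rIdeal R 2 ≤ augIdeal F ^ 3 := by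
  have h0 := rIdeal_zero_le_augIdeal R
  have h1 : rIdeal R 1 ≤ augIdeal F ^ 2 := by
    rw [pow_two]
    exact sup_le (mul_le_mul' le_rfl h0) (mul_le_mul' h0 le_rfl)
  refine sup_le ?_ ?_
  · rw [pow_succ']
    exact mul_le_mul' le_rfl h1
  · rw [pow_succ]
    exact mul_le_mul' h1 le_rfl

/-- The additive subgroup `𝔣 (S - 1) + (S - 1) 𝔣 + 𝐫(2) + 𝔣⁴`. -/
noncomputable def cubicIdeal (R S : Subgroup F) : Submodule ℤ (MonoidAlgebra ℤ F) :=
  augIdeal F * subOne S + subOne S * augIdeal F + rIdeal R 2 + augIdeal F ^ 4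

theorem cubicIdeal_le {R S : Subgroup F} {J : Submodule ℤ (MonoidAlgebra ℤ F)}
    (h₁ : augIdeal F * subOne S ≤ J) (h₂ : subOne S * augIdeal F ≤ J) (h₃ : rIdeal R 2 ≤ J)
    (h₄ : augIdeal F ^ 4 ≤ J) : cubicIdeal R S ≤ J :=
  sup_le (sup_le (sup_le h₁ h₂) h₃) h₄

theorem cubicIdeal_le_cube {R S : Subgroup F} (hS : S ≤ commutator F) :
    cubicIdeal R S ≤ augIdeal F ^ 3 := by
  refine cubicIdeal_le ?_ ?_ (rIdeal_two_le_cube R) ?_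
  · rw [pow_succ']
    exact mul_le_mul' le_rfl (subOne_le_sq hS)
  · rw [pow_succ]
    exact mul_le_mul' (subOne_le_sq hS) le_rfl
  · rw [pow_succ]
    exact augIdeal_pow_mul_augIdeal_le 2

theorem cubicIdeal_mul_augIdeal_le {R S : Subgroup F} (hS : S ≤ commutator F) :
    cubicIdeal R S * augIdeal F ≤ cubicIdeal R S := by
  refine (mul_le_mul' (cubicIdeal_le_cube hS) le_rfl).trans ?_
  rw [← pow_succ]
  exact le_sup_right

theorem commutator_sup_le_oneAddSubgroup {R S : Subgroup F} (hS : S ≤ commutator F) :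
    ⁅S, (⊤ : Subgroup F)⁆ ⊔ gammaTerm F 4 ≤
      oneAddSubgroup (cubicIdeal R S) (cubicIdeal_mul_augIdeal_le hS) := by
  refine sup_le ?_ fun w hw => ?_
  · rw [Subgroup.commutator_le]
    intro s hs g _
    have hs' : MonoidAlgebra.of ℤ F s - 1 ∈ subOne S := Submodule.subset_span ⟨s, hs, rfl⟩
    apply commutatorElement_mem_oneAddSubgroup
    · exact (le_sup_right.trans (le_sup_left.trans le_sup_left) :
        subOne S * augIdeal F ≤ cubicIdeal R S)
        (Submodule.mul_mem_mul hs' (of_sub_one_mem_augIdeal g))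
    · exact (le_sup_left.trans (le_sup_left.trans le_sup_left) :
        augIdeal F * subOne S ≤ cubicIdeal R S)
        (Submodule.mul_mem_mul (of_sub_one_mem_augIdeal g) hs')
  · exact (le_sup_right : augIdeal F ^ 4 ≤ cubicIdeal R S)
      (lowerCentralSeries_le_oneAddSubgroup 3 hw)

end DimensionSubgroup

/-! ### Descent of multilinear maps, and characters of central sections. -/

theorem exists_addMonoidHom_lift {F A D : Type*} [Group F] [AddCommGroup A] [AddCommGroup D]
    {α : F →* Multiplicative A} (hα : Function.Surjective α) (f : F → D)
    (hf : ∀ x y, f (x * y) = f x + f y) (hk : ∀ k, α k = 1 → f k = 0) :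
    ∃ β : A →+ D, ∀ x, β (α x).toAdd = f x := by
  let f' : F →* Multiplicative D := MonoidHom.mk' (fun x => .ofAdd (f x)) hf
  have h : α.ker ≤ f'.ker := fun k h => congrArg Multiplicative.ofAdd (hk k h)
  refine ⟨(α.liftOfSurjective hα ⟨f', h⟩).toAdditive, fun x => ?_⟩
  exact congrArg Multiplicative.toAdd (MonoidHom.liftOfRightInverse_comp_apply α _ _ ⟨f', h⟩ x)

theorem exists_bilinear_lift {F A D : Type*} [Group F] [AddCommGroup A] [AddCommGroup D]
    {α : F →* Multiplicative A} (hα : Function.Surjective α) (f : F → F → D)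
    (h₁ : ∀ x x' y, f (x * x') y = f x y + f x' y) (h₂ : ∀ x y y', f x (y * y') = f x y + f x y')
    (hk₁ : ∀ k y, α k = 1 → f k y = 0) (hk₂ : ∀ x k, α k = 1 → f x k = 0) :
    ∃ β : A →+ A →+ D, ∀ x y, β (α x).toAdd (α y).toAdd = f x y := by
  choose g hg using fun x => exists_addMonoidHom_lift hα (f x) (h₂ x) (hk₂ x)
  have ext {u v : A →+ D} (h : ∀ y, u (α y).toAdd = v (α y).toAdd) : u = v :=
    AddMonoidHom.ext fun a => by obtain ⟨y, hy⟩ := hα (.ofAdd a); simpa [hy] using h y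
  obtain ⟨β, hβ⟩ := exists_addMonoidHom_lift hα g
    (fun x x' => ext fun y => by rw [AddMonoidHom.add_apply, hg, hg, hg, h₁])
    (fun k hk => ext fun y => by rw [hg, hk₁ k y hk, AddMonoidHom.zero_apply])
  exact ⟨β, fun x y => by rw [hβ, hg]⟩

theorem exists_trilinear_lift {F A D : Type*} [Group F] [AddCommGroup A] [AddCommGroup D]
    {α : F →* Multiplicative A} (hα : Function.Surjective α) (f : F → F → F → D)
    (h₁ : ∀ x x' y z, f (x * x') y z = f x y z + f x' y z)
    (h₂ : ∀ x y y' z, f x (y * y') z = f x y z + f x y' z)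
    (h₃ : ∀ x y z z', f x y (z * z') = f x y z + f x y z')
    (hk₁ : ∀ k y z, α k = 1 → f k y z = 0) (hk₂ : ∀ x k z, α k = 1 → f x k z = 0)
    (hk₃ : ∀ x y k, α k = 1 → f x y k = 0) :
    ∃ β : A →+ A →+ A →+ D, ∀ x y z, β (α x).toAdd (α y).toAdd (α z).toAdd = f x y z := by
  choose g hg using fun x =>
    exists_bilinear_lift hα (f x) (h₂ x) (h₃ x) (hk₂ x) (hk₃ x)
  have ext {u v : A →+ A →+ D}
      (h : ∀ y z, u (α y).toAdd (α z).toAdd = v (α y).toAdd (α z).toAdd) : u = v :=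
    AddMonoidHom.ext fun a => AddMonoidHom.ext fun b => by
      obtain ⟨y, hy⟩ := hα (.ofAdd a)
      obtain ⟨z, hz⟩ := hα (.ofAdd b)
      simpa [hy, hz] using h y z
  obtain ⟨β, hβ⟩ := exists_addMonoidHom_lift hα g
    (fun x x' => ext fun y z => by
      rw [AddMonoidHom.add_apply, AddMonoidHom.add_apply, hg, hg, hg, h₁])
    (fun k hk => ext fun y z => by
      rw [hg, hk₁ k y z hk, AddMonoidHom.zero_apply, AddMonoidHom.zero_apply])
  exact ⟨β, fun x y z => by rw [hβ, hg]⟩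

/-- Characters into `ℚ/ℤ` separate points, and `ℚ/ℤ` embeds in `ℝ/ℤ`, whose compactness is what the
construction of `τ` needs. -/
theorem exists_addCircle_hom_ne_zero {A : Type*} [AddCommGroup A] {a : A} (ha : a ≠ 0) :
    ∃ φ : A →+ AddCircle (1 : ℝ), φ a ≠ 0 := by
  obtain ⟨χ, hχ⟩ := CharacterModule.exists_character_apply_ne_zero_of_ne_zero ha
  have hle : AddSubgroup.zmultiples (1 : ℚ) ≤
      (AddSubgroup.zmultiples (1 : ℝ)).comap (Rat.castHom ℝ).toAddMonoidHom := by
    rw [AddSubgroup.zmultiples_le]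
    exact ⟨1, by simp⟩
  let ι : AddCircle (1 : ℚ) →+ AddCircle (1 : ℝ) :=
    QuotientAddGroup.map _ _ (Rat.castHom ℝ).toAddMonoidHom hle
  refine ⟨ι.comp (χ : A →+ AddCircle (1 : ℚ)), fun h => hχ ?_⟩
  change ι (χ a) = 0 at h
  obtain ⟨q, hq⟩ := QuotientAddGroup.mk_surjective (χ a)
  rw [← hq] at h ⊢
  have h' : ((q : ℝ) : AddCircle (1 : ℝ)) = 0 := h
  refine (QuotientAddGroup.eq_zero_iff q).2 ?_
  obtain ⟨n, hn⟩ := (QuotientAddGroup.eq_zero_iff (q : ℝ)).1 h'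
  refine ⟨n, ?_⟩
  simp only [zsmul_eq_mul, mul_one] at hn ⊢
  exact_mod_cast hn

/-- A function on a group that restricts to a homomorphism on `Γ` vanishing on `N`, where `Γ` is
central modulo `N`. -/
structure IsCentralCharacter {F D : Type*} [Group F] [AddCommGroup D] (Γ N : Subgroup F)
    (φ : F → D) : Prop where
  normal : Γ.Normal
  commutator_le : ⁅Γ, (⊤ : Subgroup F)⁆ ≤ N
  map_mul : ∀ u ∈ Γ, ∀ v ∈ Γ, φ (u * v) = φ u + φ v
  map_eq_zero : ∀ u ∈ N, φ u = 0

/-- The image of `Γ` is central in `F ⧸ N`, so a character of the abelian group `center (F ⧸ N)`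
nonzero at `w` can be pulled back. -/
theorem exists_isCentralCharacter {F : Type*} [Group F] {Γ N : Subgroup F} [Γ.Normal] [N.Normal]
    (h : ⁅Γ, (⊤ : Subgroup F)⁆ ≤ N) {w : F} (hw : w ∈ Γ) (hwN : w ∉ N) :
    ∃ φ : F → AddCircle (1 : ℝ), IsCentralCharacter Γ N φ ∧ φ w ≠ 0 := by
  classical
  have hc (u : F) (hu : u ∈ Γ) : (u : F ⧸ N) ∈ Subgroup.center (F ⧸ N) := by
    rw [Subgroup.mem_center_iff]
    intro g
    obtain ⟨g, rfl⟩ := QuotientGroup.mk_surjective g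
    rw [← QuotientGroup.mk_mul, ← QuotientGroup.mk_mul, eq_comm, QuotientGroup.eq_iff_div_mem]
    have : u * g / (g * u) = ⁅u, g⁆ := by rw [commutatorElement_def, div_eq_mul_inv]; group
    rw [this]
    exact h (Subgroup.commutator_mem_commutator hu (Subgroup.mem_top _))
  let _ : CommGroup (Subgroup.center (F ⧸ N)) :=
    { (inferInstance : Group (Subgroup.center (F ⧸ N))) with
      mul_comm := fun a b => Subtype.ext (Subgroup.mem_center_iff.1 b.2 a) }
  obtain ⟨φ, hφ⟩ := exists_addCircle_hom_ne_zero
    (A := Additive (Subgroup.center (F ⧸ N))) (a := .ofMul ⟨(w : F ⧸ N), hc w hw⟩) (fun h0 => hwN <|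
      (QuotientGroup.eq_one_iff w).1 (congrArg (fun a => (Additive.toMul a).1) h0))
  -- The value `0` off the preimage of the centre is a mere default.
  let f : F → AddCircle (1 : ℝ) := fun u =>
    if hu : (u : F ⧸ N) ∈ Subgroup.center (F ⧸ N) then φ (.ofMul ⟨u, hu⟩) else 0
  refine ⟨f, ⟨inferInstance, h, fun u hu v hv => ?_, fun u hu => ?_⟩, ?_⟩
  · simp only [f]
    rw [dif_pos (hc u hu), dif_pos (hc v hv), dif_pos (hc _ (Γ.mul_mem hu hv)), ← φ.map_add]
    rfl
  · have h1 : (u : F ⧸ N) = 1 := (QuotientGroup.eq_one_iff u).2 hu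
    simp only [f, h1]
    rw [dif_pos (one_mem _)]
    exact φ.map_zero
  · simp only [f]
    rwa [dif_pos (hc w hw)]

namespace IsCentralCharacter

variable {F D : Type*} [Group F] [AddCommGroup D] {Γ N M : Subgroup F} {φ : F → D}
  (hφ : IsCentralCharacter Γ N φ)
include hφ

theorem map_one : φ 1 = 0 := hφ.map_eq_zero 1 (one_mem _)

theorem map_inv {u : F} (hu : u ∈ Γ) : φ u⁻¹ = -φ u := by
  rw [eq_neg_iff_add_eq_zero, ← hφ.map_mul _ (inv_mem hu) _ hu, inv_mul_cancel, hφ.map_one]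

theorem map_conj {u : F} (hu : u ∈ Γ) (g : F) : φ (g * u * g⁻¹) = φ u := by
  have h : ⁅u, g⁆⁻¹ * u = g * u * g⁻¹ := by rw [commutatorElement_def]; group
  have h' : ⁅u, g⁆ ∈ N := hφ.commutator_le (Subgroup.commutator_mem_commutator hu (Subgroup.mem_top _))
  have h'' : ⁅u, g⁆⁻¹ ∈ Γ := by
    have := mul_mem (hφ.normal.conj_mem u hu g) (inv_mem hu)
    rwa [← h, mul_inv_cancel_right] at this
  rw [← h, hφ.map_mul _ h'' _ hu, hφ.map_eq_zero _ (inv_mem h'), zero_add]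

variable (hM : ⁅M, (⊤ : Subgroup F)⁆ ≤ Γ)
include hM

theorem commutator_mul_left {a b : F} (ha : a ∈ M) (hb : b ∈ M) (z : F) :
    φ ⁅a * b, z⁆ = φ ⁅a, z⁆ + φ ⁅b, z⁆ := by
  have ha' : ⁅a, z⁆ ∈ Γ := hM (Subgroup.commutator_mem_commutator ha (Subgroup.mem_top _))
  have hb' : ⁅b, z⁆ ∈ Γ := hM (Subgroup.commutator_mem_commutator hb (Subgroup.mem_top _))
  have h : ⁅a * b, z⁆ = a * ⁅b, z⁆ * a⁻¹ * ⁅a, z⁆ := by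
    simp only [commutatorElement_def]; group
  rw [h, hφ.map_mul _ (hφ.normal.conj_mem _ hb' a) _ ha', hφ.map_conj hb', add_comm]

theorem commutator_mul_right {a : F} (ha : a ∈ M) (y z : F) :
    φ ⁅a, y * z⁆ = φ ⁅a, y⁆ + φ ⁅a, z⁆ := by
  have hy : ⁅a, y⁆ ∈ Γ := hM (Subgroup.commutator_mem_commutator ha (Subgroup.mem_top _))
  have hz : ⁅a, z⁆ ∈ Γ := hM (Subgroup.commutator_mem_commutator ha (Subgroup.mem_top _))
  have h : ⁅a, y * z⁆ = ⁅a, y⁆ * (y * ⁅a, z⁆ * y⁻¹) := by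
    simp only [commutatorElement_def]; group
  rw [h, hφ.map_mul _ hy _ (hφ.normal.conj_mem _ hz y), hφ.map_conj hz]

theorem commutator_inv_left {a : F} (ha : a ∈ M) (z : F) : φ ⁅a⁻¹, z⁆ = -φ ⁅a, z⁆ := by
  rw [eq_neg_iff_add_eq_zero, ← hφ.commutator_mul_left hM (inv_mem ha) ha, inv_mul_cancel,
    commutatorElement_one_left, hφ.map_one]

theorem commutator_conj_right {a : F} (ha : a ∈ M) (y z : F) :
    φ ⁅a, y * z * y⁻¹⁆ = φ ⁅a, z⁆ := by
  have h : φ ⁅a, y⁆ + φ ⁅a, y⁻¹⁆ = 0 := by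
    rw [← hφ.commutator_mul_right hM ha, mul_inv_cancel, commutatorElement_one_right, hφ.map_one]
  rw [hφ.commutator_mul_right hM ha, hφ.commutator_mul_right hM ha, add_right_comm, h, zero_add]

end IsCentralCharacter

namespace IsCentralCharacter

variable {F D : Type*} [Group F] [AddCommGroup D] {N : Subgroup F} {φ : F → D}
  (hφ : IsCentralCharacter ⁅commutator F, (⊤ : Subgroup F)⁆ N φ)
include hφ

theorem commutator_of_mem {n : F} (hn : n ∈ ⁅commutator F, (⊤ : Subgroup F)⁆) (z : F) :
    φ ⁅n, z⁆ = 0 :=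
  hφ.map_eq_zero _ (hφ.commutator_le (Subgroup.commutator_mem_commutator hn (Subgroup.mem_top _)))

/-- `[x x', y]` differs from `[x', y] [x, y]` by an element of `γ₃(F)`, which `φ [·, z]` ignores. -/
theorem triple_mul_left (x x' y z : F) :
    φ ⁅⁅x * x', y⁆, z⁆ = φ ⁅⁅x, y⁆, z⁆ + φ ⁅⁅x', y⁆, z⁆ := by
  have hx : ⁅x, y⁆ ∈ commutator F := Subgroup.commutator_mem_commutator trivial trivial
  have hx' : ⁅x', y⁆ ∈ commutator F := Subgroup.commutator_mem_commutator trivial trivial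
  have hn : ⁅⁅x', y⁆, x⁆⁻¹ ∈ ⁅commutator F, (⊤ : Subgroup F)⁆ :=
    inv_mem (Subgroup.commutator_mem_commutator hx' trivial)
  have h : ⁅x * x', y⁆ = ⁅⁅x', y⁆, x⁆⁻¹ * (⁅x', y⁆ * ⁅x, y⁆) := by
    simp only [commutatorElement_def]; group
  have hle : ⁅commutator F, (⊤ : Subgroup F)⁆ ≤ commutator F := Subgroup.commutator_le_left _ _
  rw [h, hφ.commutator_mul_left le_rfl (hle hn) (mul_mem hx' hx),
    hφ.commutator_mul_left le_rfl hx' hx, hφ.commutator_of_mem hn, zero_add, add_comm]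

theorem triple_swap (x y z : F) : φ ⁅⁅y, x⁆, z⁆ = -φ ⁅⁅x, y⁆, z⁆ := by
  rw [← commutatorElement_inv x y, hφ.commutator_inv_left le_rfl
    (Subgroup.commutator_mem_commutator trivial trivial)]

theorem triple_mul_mid (x y y' z : F) :
    φ ⁅⁅x, y * y'⁆, z⁆ = φ ⁅⁅x, y⁆, z⁆ + φ ⁅⁅x, y'⁆, z⁆ := by
  rw [hφ.triple_swap, hφ.triple_mul_left, hφ.triple_swap y x, hφ.triple_swap y' x, neg_add]

theorem triple_mul_right (x y z z' : F) :
    φ ⁅⁅x, y⁆, z * z'⁆ = φ ⁅⁅x, y⁆, z⁆ + φ ⁅⁅x, y⁆, z'⁆ :=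
  hφ.commutator_mul_right le_rfl (Subgroup.commutator_mem_commutator trivial trivial) z z'

theorem triple_jacobi (x y z : F) :
    φ ⁅⁅x, y⁆, z⁆ + φ ⁅⁅y, z⁆, x⁆ + φ ⁅⁅z, x⁆, y⁆ = 0 := by
  have hall_witt : ⁅⁅x, y⁆, y * z * y⁻¹⁆ * ⁅⁅y, z⁆, z * x * z⁻¹⁆ * ⁅⁅z, x⁆, x * y * x⁻¹⁆ = 1 := by
    simp only [commutatorElement_def]; group
  have hm (x y : F) : ⁅x, y⁆ ∈ commutator F := Subgroup.commutator_mem_commutator trivial trivial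
  have hm₃ (x y z : F) : ⁅⁅x, y⁆, z⁆ ∈ ⁅commutator F, (⊤ : Subgroup F)⁆ :=
    Subgroup.commutator_mem_commutator (hm x y) trivial
  have h := congrArg φ hall_witt
  rwa [hφ.map_mul _ (mul_mem (hm₃ _ _ _) (hm₃ _ _ _)) _ (hm₃ _ _ _),
    hφ.map_mul _ (hm₃ _ _ _) _ (hm₃ _ _ _), hφ.map_one,
    hφ.commutator_conj_right le_rfl (hm _ _), hφ.commutator_conj_right le_rfl (hm _ _),
    hφ.commutator_conj_right le_rfl (hm _ _)] at h

end IsCentralCharacter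

/-! ### Matrix entries on commutators and on the cubic ideal. -/

namespace CubicCocycle

open DimensionSubgroup

variable {F : Type*} [Group F] {A B D : Type*} [AddCommGroup A] [AddCommGroup B] [AddCommGroup D]
  {ν₁ : A →+ A →+ B} {ν₂ : A →+ B →+ D} (T : CubicCocycle F ν₁ ν₂)

theorem c_one (x : A) : T.c 1 x = 0 := by simpa [T.a_one] using T.c_mul 1 1 x

theorem a_commutator (g h : F) : T.a ⁅g, h⁆ = 0 :=
  T.a_eq_zero (Subgroup.commutator_mem_commutator (Subgroup.mem_top g) (Subgroup.mem_top h))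

theorem b_commutator (g h : F) :
    T.b ⁅g, h⁆ = ν₁ (T.a g) (T.a h) - ν₁ (T.a h) (T.a g) := by
  have h1 : T.b (⁅g, h⁆ * (h * g)) = T.b (g * h) := by
    congr 1; rw [commutatorElement_def]; group
  rw [T.b_mul, T.a_commutator, map_zero, AddMonoidHom.zero_apply, add_zero, T.b_mul, T.b_mul] at h1
  rw [eq_sub_iff_add_eq, ← add_right_inj (T.b g + T.b h), ← h1]
  abel

theorem c_commutator (g h : F) (x : A) :
    T.c ⁅g, h⁆ x = ν₂ (T.a g) (ν₁ (T.a h) x) - ν₂ (T.a h) (ν₁ (T.a g) x) := by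
  have h1 : T.c (⁅g, h⁆ * (h * g)) x = T.c (g * h) x := by
    congr 2; rw [commutatorElement_def]; group
  rw [T.c_mul, T.a_commutator, map_zero, AddMonoidHom.zero_apply, add_zero, T.c_mul, T.c_mul] at h1
  rw [eq_sub_iff_add_eq, ← add_right_inj (T.c g x + T.c h x), ← h1]
  abel

theorem d_commutator {s : F} (ha : T.a s = 0) (hb : T.b s = 0) (z : F) :
    T.d ⁅s, z⁆ = T.c s (T.a z) := by
  have h1 : T.d (⁅s, z⁆ * (z * s)) = T.d (s * z) := by
    congr 1; rw [commutatorElement_def]; group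
  have h2 : T.c ⁅s, z⁆ (T.a (z * s)) = 0 := by
    rw [T.c_commutator, ha]; simp
  rw [T.d_mul, T.a_commutator, h2, T.d_mul, T.d_mul, ha, hb] at h1
  simp only [map_zero, AddMonoidHom.zero_apply, add_zero] at h1
  rw [← add_right_inj (T.d s + T.d z), ← h1]
  abel

theorem b_eq_of_mem_commutator {N : Subgroup F} {φ : F → B}
    (hφ : IsCentralCharacter (commutator F) N φ)
    (h : ∀ g h, ν₁ (T.a g) (T.a h) - ν₁ (T.a h) (T.a g) = φ ⁅g, h⁆) {w : F}
    (hw : w ∈ commutator F) : T.b w = φ w := by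
  rw [commutator_def, Subgroup.commutator_def] at hw
  induction hw using Subgroup.closure_induction with
  | mem x hx => obtain ⟨g, -, k, -, rfl⟩ := hx; rw [T.b_commutator, h]
  | one => rw [T.b_one, hφ.map_one]
  | mul x y hx hy ihx ihy =>
    rw [T.b_mul, T.a_eq_zero hx, map_zero, AddMonoidHom.zero_apply, add_zero, ihx, ihy,
      hφ.map_mul x hx y hy]
  | inv x hx ihx =>
    rw [hφ.map_inv hx, ← ihx, eq_neg_iff_add_eq_zero, ← T.b_one, ← inv_mul_cancel x, T.b_mul,
      T.a_eq_zero hx, map_zero, add_zero]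

theorem b_eq_zero_of_symmetric (h : ∀ x y, ν₁ x y = ν₁ y x) {w : F} (hw : w ∈ commutator F) :
    T.b w = 0 :=
  T.b_eq_of_mem_commutator (N := ⊤) (φ := fun _ => 0)
    ⟨inferInstance, le_top, fun _ _ _ _ => (add_zero _).symm, fun _ _ => rfl⟩
    (fun _ _ => by rw [h, sub_self]) hw

section

variable {N : Subgroup F} {φ : F → D}
  (hφ : IsCentralCharacter ⁅commutator F, (⊤ : Subgroup F)⁆ N φ)
  (h : ∀ x y z : F, T.c ⁅x, y⁆ (T.a z) = φ ⁅⁅x, y⁆, z⁆)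
include hφ h

theorem c_eq_of_mem_commutator {s : F} (hs : s ∈ commutator F) (z : F) :
    T.c s (T.a z) = φ ⁅s, z⁆ := by
  rw [commutator_def, Subgroup.commutator_def] at hs
  induction hs using Subgroup.closure_induction with
  | mem x hx => obtain ⟨g, -, k, -, rfl⟩ := hx; rw [h]
  | one => rw [T.c_one, commutatorElement_one_left, hφ.map_one]
  | mul x y hx hy ihx ihy =>
    rw [T.c_mul, T.a_eq_zero hx, map_zero, AddMonoidHom.zero_apply, add_zero, ihx, ihy,
      hφ.commutator_mul_left le_rfl hx hy]
  | inv x hx ihx =>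
    rw [hφ.commutator_inv_left le_rfl hx, ← ihx, eq_neg_iff_add_eq_zero, ← T.c_one (T.a z),
      ← inv_mul_cancel x, T.c_mul, T.a_eq_zero hx, map_zero, AddMonoidHom.zero_apply, map_zero,
      add_zero]

/-- Symmetry of `ν₁` kills `b` on `F'`, so `d [s, z] = c s (a z) = φ [s, z]` there; the cross terms
of `d` vanish on `γ₃(F)`, where both sides are additive. -/
theorem d_eq_of_mem (hν : ∀ x y, ν₁ x y = ν₁ y x) {w : F}
    (hw : w ∈ ⁅commutator F, (⊤ : Subgroup F)⁆) : T.d w = φ w := by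
  have hle : ⁅commutator F, (⊤ : Subgroup F)⁆ ≤ commutator F := Subgroup.commutator_le_left _ _
  have hb {s : F} (hs : s ∈ commutator F) : T.b s = 0 := T.b_eq_zero_of_symmetric hν hs
  have hc {n : F} (hn : n ∈ ⁅commutator F, (⊤ : Subgroup F)⁆) (z : F) : T.c n (T.a z) = 0 := by
    rw [T.c_eq_of_mem_commutator hφ h (hle hn), hφ.commutator_of_mem hn]
  rw [Subgroup.commutator_def] at hw
  induction hw using Subgroup.closure_induction with
  | mem x hx =>
    obtain ⟨s, hs, z, -, rfl⟩ := hx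
    rw [T.d_commutator (T.a_eq_zero hs) (hb hs), T.c_eq_of_mem_commutator hφ h hs]
  | one => rw [T.d_one, hφ.map_one]
  | mul x y hx hy ihx ihy =>
    rw [T.d_mul, T.a_eq_zero (hle hx), hc hx, map_zero, AddMonoidHom.zero_apply, add_zero,
      add_zero, ihx, ihy, hφ.map_mul x hx y hy]
  | inv x hx ihx =>
    rw [hφ.map_inv hx, ← ihx, eq_neg_iff_add_eq_zero, ← T.d_one, ← inv_mul_cancel x, T.d_mul,
      T.a_eq_zero (hle hx), hb (hle hx), map_zero, map_zero, add_zero, add_zero]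

end

theorem linearExtension_of_sub_one {D : Type*} [AddCommGroup D] {t : F → D} (h : t 1 = 0) (w : F) :
    linearExtension t (MonoidAlgebra.of ℤ F w - 1) = t w := by
  rw [map_sub, linearExtension_of, linearExtension_one, h, sub_zero]

theorem augIdeal_cube_le : augIdeal F ^ 3 ≤ T.kerB := by
  rw [pow_succ', pow_two]
  exact T.augIdeal_mul_augIdeal_mul_augIdeal_le

/-- `𝐫(2)` and `𝔣⁴` go by weight. For `𝔣 (S - 1)`, symmetry of `ν₁` puts `S - 1` in `kerB`; for `(S
- 1) 𝔣`, the surviving term is `c s`, zero by hypothesis. -/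
theorem cubicIdeal_le_ker {R S : Subgroup F} (hR : ∀ r ∈ R, T.a r = 0) (hS : S ≤ commutator F)
    (hν : ∀ x y, ν₁ x y = ν₁ y x) (hc : ∀ s ∈ S, ∀ x, T.c s x = 0) :
    cubicIdeal R S ≤ LinearMap.ker (linearExtension T.d) := by
  have hD : T.kerD ≤ LinearMap.ker (linearExtension T.d) := inf_le_right
  refine cubicIdeal_le ?_ ?_ ((T.rIdeal_two_le_kerD hR).trans hD)
    (T.augIdeal_pow_four_le.trans hD)
  · refine (mul_le_mul' le_rfl ?_).trans (T.augIdeal_mul_kerB_le.trans hD)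
    rw [subOne, Submodule.span_le]
    rintro _ ⟨s, hs, rfl⟩
    exact ⟨⟨of_sub_one_mem_augIdeal s, (linearExtension_of_sub_one T.a_one s).trans
      (T.a_eq_zero (hS hs))⟩, (linearExtension_of_sub_one T.b_one s).trans
      (T.b_eq_zero_of_symmetric hν (hS hs))⟩
  · refine subOne_mul_le fun s hs u hu => ?_
    rw [LinearMap.mem_ker, T.linearExtension_d_mul, mem_augIdeal.1 hu, zero_smul, hc s hs,
      T.a_eq_zero (hS hs), map_zero, AddMonoidHom.zero_apply, add_zero, add_zero]

end CubicCocycle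

/-! ### Low-degree dimension subgroups and the hard inclusion. -/

namespace DimensionSubgroup

variable {F : Type*} [Group F]

theorem mem_commutator_of_mem_augIdeal_cube [IsFreeGroup F] {w : F}
    (hw : MonoidAlgebra.of ℤ F w - 1 ∈ augIdeal F ^ 3) : w ∈ commutator F := by
  obtain ⟨T, hT⟩ := CubicCocycle.exists_of_isFreeGroup
    (0 : Additive (Abelianization F) →+ Additive (Abelianization F) →+ Unit)
    (0 : _ →+ _ →+ Unit) (Abelianization.of (G := F))
  have h : T.a w = 0 := by
    rw [← CubicCocycle.linearExtension_of_sub_one T.a_one w]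
    exact (T.augIdeal_cube_le hw).1.2
  rw [hT] at h
  rw [← Abelianization.ker_of]
  exact h

/-- Quadratic analogue of `τ`: order the free generators and keep the bracket only for `i < j`;
bilinearity in `F` makes agreement on generators enough. -/
theorem exists_antisymmetrization [IsFreeGroup F] {D : Type*} [AddCommGroup D] {N : Subgroup F}
    {φ : F → D} (hφ : IsCentralCharacter (commutator F) N φ) :
    ∃ ν : Additive (Abelianization F) →+ Additive (Abelianization F) →+ D, ∀ g h : F,
      ν (.ofMul (Abelianization.of g)) (.ofMul (Abelianization.of h)) -
        ν (.ofMul (Abelianization.of h)) (.ofMul (Abelianization.of g)) = φ ⁅g, h⁆ := by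
  classical
  let _ : LinearOrder (IsFreeGroup.Generators F) := linearOrderOfSTO WellOrderingRel
  let μ : F →* F →* Multiplicative D := IsFreeGroup.lift fun i => IsFreeGroup.lift fun j =>
    if i < j then .ofAdd (φ ⁅IsFreeGroup.of i, IsFreeGroup.of j⁆) else 1
  have hM : ⁅(⊤ : Subgroup F), (⊤ : Subgroup F)⁆ ≤ commutator F := le_rfl
  let E : F →* F →* Multiplicative D := MonoidHom.mk' (fun g => MonoidHom.mk'
      (fun h => .ofAdd (φ ⁅g, h⁆))
      fun h h' => congrArg Multiplicative.ofAdd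
        (hφ.commutator_mul_right hM (Subgroup.mem_top g) h h'))
    fun g g' => MonoidHom.ext fun h => congrArg Multiplicative.ofAdd
      (hφ.commutator_mul_left hM (Subgroup.mem_top g) (Subgroup.mem_top g') h)
  have hswap (g h : F) : φ ⁅g, h⁆ = -φ ⁅h, g⁆ := by
    rw [← commutatorElement_inv h g, hφ.map_inv
      (Subgroup.commutator_mem_commutator (Subgroup.mem_top h) (Subgroup.mem_top g))]
  have hμ : μ / μ.flip = E := by
    refine IsFreeGroup.ext_hom fun i => IsFreeGroup.ext_hom fun j => ?_
    change μ (IsFreeGroup.of i) (IsFreeGroup.of j) / μ (IsFreeGroup.of j) (IsFreeGroup.of i) =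
      .ofAdd (φ ⁅IsFreeGroup.of i, IsFreeGroup.of j⁆)
    simp only [μ, IsFreeGroup.lift_of]
    rcases lt_trichotomy i j with h | rfl | h
    · simp [h, h.not_gt]
    · simp [hφ.map_one]
    · rw [if_neg h.not_gt, if_pos h, hswap, ofAdd_neg, one_div, inv_inv]
  have hcomm {k : F} (hk : Abelianization.of k = 1) : k ∈ commutator F :=
    Abelianization.ker_of F ▸ hk
  obtain ⟨ν, hν⟩ := exists_bilinear_lift (A := Additive (Abelianization F)) (D := D)
    (α := Abelianization.of (G := F)) QuotientGroup.mk_surjective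
    (fun x y => (μ x y).toAdd)
    (fun x x' y => by rw [map_mul]; rfl) (fun x y y' => by rw [map_mul]; rfl)
    (fun k y hk => by rw [show μ k = 1 from Abelianization.commutator_subset_ker μ (hcomm hk)]; rfl)
    (fun x k hk => congrArg Multiplicative.toAdd
      (Abelianization.commutator_subset_ker (μ x) (hcomm hk)))
  refine ⟨ν, fun g h => ?_⟩
  have := congrArg Multiplicative.toAdd (DFunLike.congr_fun (DFunLike.congr_fun hμ g) h)
  rw [← show _ = φ ⁅g, h⁆ from this]
  exact congrArg₂ (· - ·) (hν g h) (hν h g)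

/-- Same scheme one degree lower: a character of `F'/γ₃(F)` is realised by the entry `b`, which
kills `𝔣³`. -/
theorem mem_commutator_commutator_of_mem_augIdeal_cube [IsFreeGroup F] {w : F}
    (hw : MonoidAlgebra.of ℤ F w - 1 ∈ augIdeal F ^ 3) :
    w ∈ ⁅commutator F, (⊤ : Subgroup F)⁆ := by
  have hw' := mem_commutator_of_mem_augIdeal_cube hw
  by_contra hN
  obtain ⟨φ, hφ, hne⟩ := exists_isCentralCharacter le_rfl hw' hN
  obtain ⟨ν, hν⟩ := exists_antisymmetrization hφ
  obtain ⟨T, hT⟩ := CubicCocycle.exists_of_isFreeGroup ν (0 : _ →+ _ →+ Unit)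
    (Abelianization.of (G := F))
  apply hne
  rw [← T.b_eq_of_mem_commutator hφ (fun g h => by rw [hT, hT]; exact hν g h) hw',
    ← CubicCocycle.linearExtension_of_sub_one T.b_one w]
  exact (T.augIdeal_cube_le hw).2

/-- The homomorphism from `F` to the abelianization of `F ⧸ R`. -/
def toAbelianizationQuotient (R : Subgroup F) [R.Normal] :
    F →* Multiplicative (Additive (Abelianization (F ⧸ R))) :=
  (Abelianization.of (G := F ⧸ R)).comp (QuotientGroup.mk' R)

theorem toAbelianizationQuotient_surjective (R : Subgroup F) [R.Normal] :
    Function.Surjective (toAbelianizationQuotient R) :=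
  (QuotientGroup.mk_surjective (s := commutator (F ⧸ R))).comp QuotientGroup.mk_surjective

theorem map_eq_one_of_toAbelianizationQuotient_eq_one {R : Subgroup F} [R.Normal] {M : Type*}
    [CommGroup M] (f : F →* M) (hf : ∀ r ∈ R, f r = 1) {k : F}
    (hk : toAbelianizationQuotient R k = 1) : f k = 1 := by
  have hk' : (k : F ⧸ R) ∈ commutator (F ⧸ R) := by
    rw [← Abelianization.ker_of]
    exact hk
  exact Abelianization.commutator_subset_ker (QuotientGroup.lift R f hf) hk'

theorem toAbelianizationQuotient_eq_one {R : Subgroup F} [R.Normal] {r : F} (hr : r ∈ R) :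
    toAbelianizationQuotient R r = 1 := by
  change Abelianization.of (r : F ⧸ R) = 1
  rw [(QuotientGroup.eq_one_iff r).2 hr, map_one]

/-- For `r ∈ R`, normality puts `[r, y]` in `R ∩ F'`, so `φ` kills `[[r, y], z]`; antisymmetry and
Jacobi move `r` to the other slots. -/
theorem exists_trilinear_of_isCentralCharacter {R : Subgroup F} [R.Normal] {D : Type*}
    [AddCommGroup D] {N : Subgroup F} {φ : F → D}
    (hφ : IsCentralCharacter ⁅commutator F, (⊤ : Subgroup F)⁆ N φ)
    (hN : ⁅R ⊓ commutator F, (⊤ : Subgroup F)⁆ ≤ N) :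
    ∃ β : Additive (Abelianization (F ⧸ R)) →+ Additive (Abelianization (F ⧸ R)) →+
        Additive (Abelianization (F ⧸ R)) →+ D,
      ∀ x y z, β (toAbelianizationQuotient R x).toAdd (toAbelianizationQuotient R y).toAdd
        (toAbelianizationQuotient R z).toAdd = φ ⁅⁅x, y⁆, z⁆ := by
  have hR₁ {r : F} (hr : r ∈ R) (y z : F) : φ ⁅⁅r, y⁆, z⁆ = 0 := by
    refine hφ.map_eq_zero _ (hN (Subgroup.commutator_mem_commutator ⟨?_, ?_⟩ (Subgroup.mem_top z)))
    · exact Subgroup.commutator_le_left R ⊤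
        (Subgroup.commutator_mem_commutator hr (Subgroup.mem_top y))
    · exact Subgroup.commutator_mem_commutator (Subgroup.mem_top r) (Subgroup.mem_top y)
  have hR₂ {r : F} (hr : r ∈ R) (x z : F) : φ ⁅⁅x, r⁆, z⁆ = 0 := by
    rw [hφ.triple_swap, hR₁ hr, neg_zero]
  have hR₃ {r : F} (hr : r ∈ R) (x y : F) : φ ⁅⁅x, y⁆, r⁆ = 0 := by
    have := hφ.triple_jacobi x y r
    rwa [hR₁ hr, hR₂ hr, add_zero, add_zero] at this
  have kill (f : F → D) (hf : ∀ x y, f (x * y) = f x + f y) (hr : ∀ r ∈ R, f r = 0) (k : F)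
      (hk : toAbelianizationQuotient R k = 1) : f k = 0 :=
    congrArg Multiplicative.toAdd (map_eq_one_of_toAbelianizationQuotient_eq_one
      (MonoidHom.mk' (fun x => Multiplicative.ofAdd (f x)) hf)
      (fun r h => congrArg Multiplicative.ofAdd (hr r h)) hk)
  exact exists_trilinear_lift (toAbelianizationQuotient_surjective R)
    (fun x y z => φ ⁅⁅x, y⁆, z⁆) hφ.triple_mul_left hφ.triple_mul_mid hφ.triple_mul_right
    (fun k y z => kill (fun k => φ ⁅⁅k, y⁆, z⁆) (fun x x' => hφ.triple_mul_left x x' y z)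
      (fun r hr => hR₁ hr y z) k)
    (fun x k z => kill (fun k => φ ⁅⁅x, k⁆, z⁆) (fun y y' => hφ.triple_mul_mid x y y' z)
      (fun r hr => hR₂ hr x z) k)
    (fun x y k => kill (fun k => φ ⁅⁅x, y⁆, k⁆) (fun z z' => hφ.triple_mul_right x y z z')
      (fun r hr => hR₃ hr x y) k)

theorem mem_of_mem_cubicIdeal [IsFreeGroup F] {R : Subgroup F} [R.Normal] {w : F}
    (hw : MonoidAlgebra.of ℤ F w - 1 ∈ cubicIdeal R (R ⊓ commutator F)) :
    w ∈ ⁅R ⊓ commutator F, (⊤ : Subgroup F)⁆ ⊔ gammaTerm F 4 := by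
  have hS : R ⊓ commutator F ≤ commutator F := inf_le_right
  have hw' := mem_commutator_commutator_of_mem_augIdeal_cube (cubicIdeal_le_cube hS hw)
  have hγ : ⁅⁅commutator F, (⊤ : Subgroup F)⁆, (⊤ : Subgroup F)⁆ ≤ gammaTerm F 4 := le_rfl
  have : (gammaTerm F 4).Normal :=
    inferInstanceAs ((⊤ : Subgroup F).lowerCentralSeries 3).Normal
  by_contra hN
  obtain ⟨φ, hφ, hne⟩ := exists_isCentralCharacter (hγ.trans le_sup_right) hw' hN
  obtain ⟨β, hβ⟩ := exists_trilinear_of_isCentralCharacter hφ le_sup_left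
  have lift (a : Additive (Abelianization (F ⧸ R))) :
      ∃ x, (toAbelianizationQuotient R x).toAdd = a := toAbelianizationQuotient_surjective R a
  obtain ⟨τ, hsymm, hτ⟩ := exists_symmetric_of_jacobi β
    (fun a c => by
      obtain ⟨x, rfl⟩ := lift a
      obtain ⟨z, rfl⟩ := lift c
      rw [hβ, commutatorElement_self, commutatorElement_one_left, hφ.map_one])
    (fun a b c => by
      obtain ⟨x, rfl⟩ := lift a
      obtain ⟨y, rfl⟩ := lift b
      obtain ⟨z, rfl⟩ := lift c
      rw [hβ, hβ, hβ, hφ.triple_jacobi])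
  -- Here `B = A →+ D`, `ν₁ x y` is `a ↦ τ a x y` and `ν₂` is evaluation, so `ν₂ a (ν₁ x y) = τ a x
  -- y`.
  obtain ⟨T, hT⟩ := CubicCocycle.exists_of_isFreeGroup (AddMonoidHom.flipHom.comp τ.flip)
    AddMonoidHom.eval (toAbelianizationQuotient R)
  have hν (x y) : (AddMonoidHom.flipHom.comp τ.flip) x y =
      (AddMonoidHom.flipHom.comp τ.flip) y x := AddMonoidHom.ext fun a => hsymm a x y
  have hc (x y z : F) : T.c ⁅x, y⁆ (T.a z) = φ ⁅⁅x, y⁆, z⁆ := by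
    rw [T.c_commutator, hT, hT, hT, ← hβ]
    exact hτ _ _ _
  apply hne
  rw [← T.d_eq_of_mem hφ hc hν hw', ← CubicCocycle.linearExtension_of_sub_one T.d_one w]
  refine T.cubicIdeal_le_ker (fun r hr => ?_) hS hν (fun s hs a => ?_) hw
  · rw [hT, toAbelianizationQuotient_eq_one hr, toAdd_one]
  · obtain ⟨z, rfl⟩ := lift a
    rw [← hT, T.c_eq_of_mem_commutator hφ hc (hS hs)]
    exact hφ.map_eq_zero _ (Subgroup.mem_sup_left
      (Subgroup.commutator_mem_commutator hs (Subgroup.mem_top z)))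

end DimensionSubgroup

theorem mainTheorem6 {F : Type*} [Group F] [IsFreeGroup F] (R : Subgroup F) [R.Normal] :
    DimensionSubgroup.interOneAdd
        (DimensionSubgroup.augIdeal F * DimensionSubgroup.subOne (R ⊓ commutator F)
          + DimensionSubgroup.subOne (R ⊓ commutator F) * DimensionSubgroup.augIdeal F
          + DimensionSubgroup.rIdeal R 2
          + DimensionSubgroup.augIdeal F ^ 4)
      = ((⁅R ⊓ commutator F, (⊤ : Subgroup F)⁆ ⊔ DimensionSubgroup.gammaTerm F 4 :
          Subgroup F) : Set F) := by
  ext w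
  refine DimensionSubgroup.mem_interOneAdd.trans
    ⟨DimensionSubgroup.mem_of_mem_cubicIdeal, fun hw => ?_⟩
  exact DimensionSubgroup.commutator_sup_le_oneAddSubgroup (R := R) inf_le_right hw
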